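/- Work with oriented virtual knots, i.e. equivalence classes of Gauss diagrams modulo the Gauss-diagram Reidemeister moves I, II and III. A virtual knot is classical if it is represented by a Gauss diagram of a knot diagram on the sphere without virtual crossings. A virtual pseudodiagram is an oriented virtual knot diagram in which some of the non-virtual crossings are undetermined ("precrossings"); a precrossing is resolved by choosing its local writhe $\pm1$, which turns it into a positive or negative classical crossing. A virtual shadow is a virtual pseudodiagram all of whose non-virtual crossings are precrossings. The classicalizing number $\mathrm{cl}(V)\in\{0,1,2,\dots\}\cup\{\infty\}$ of a virtual pseudodiagram $V$ is the minimum number of precrossings of $V$ which must be resolved (with suitably chosen writhes) so that every way of resolving all the remaining precrossings yields a classical knot; $\mathrm{cl}(V)=\infty$ if no resolution of $V$ is classical. For a precrossing $c$ of a virtual shadow $S$, smoothing at $c$ according to the orientation produces two oriented components $L_1,L_2$, where $L_1$ is the one leaving $c$ along the strand that crosses the other strand at $c$ from left to right. The intersection index $\mathrm{ind}(c)\in\mathbb{Z}$ is the sum, over the precrossings between $L_1$ and $L_2$ (self-crossings of $L_1$ or $L_2$, $c$ itself and virtual crossings are not counted), of the sign which is $+1$ if $L_1$ crosses $L_2$ from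 left to right there and $-1$ if it crosses from right to left. (Another ordering of the two components only changes the sign of $\mathrm{ind}(c)$.) For $m\in\mathbb{Z}$ let $C_m$ be the set of precrossings $c$ of $S$ with $\mathrm{ind}(c)=m$. **Proposition.** For every virtual shadow $S$, $$\mathrm{cl}(S)\;\ge\;\sum_{m\in\mathbb{Z},\,m\neq 0}|C_m| .$$ -/

import Mathlib

/-!
Virtual knots are treated as equivalence classes of (signed, oriented) Gauss diagrams under the
Gauss diagram forms of the Reidemeister moves; virtual crossings leave no trace on a Gauss diagram.
-/

namespace VirtualKnot

/-- An oriented virtual knot diagram with the over/under information of all its classical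
crossings forgotten, recorded by its core circle.

`n` is the number of (flat, non-virtual) crossings.  Every crossing `c` has two preimages on the
core circle.  The preimage `(c, true)` is the strand through `c` that crosses the other strand
*from left to right*; the preimage `(c, false)` is the strand that crosses the other one from
right to left.  (So if the strand `(c, true)` points east, then the strand `(c, false)` points
north.)  The permutation `next` sends each preimage to the one that follows it on the oriented
core circle; all preimages lie on one circle. -/
structure FlatDiagram where
  n : ℕ
  next : Equiv.Perm (Fin n × Bool)
  single_circle : ∀ x y, next.SameCycle x y

/-- A preimage of a crossing on the core circle, i.e. one end of the corresponding chord. -/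
abbrev FlatDiagram.End (S : FlatDiagram) : Type := Fin S.n × Bool

/-- A virtual knot diagram: every (non-virtual) crossing carries its local writhe. -/
structure VirtualDiagram extends FlatDiagram where
  writhe : Fin n → ℤˣ

/-- A virtual pseudodiagram: some (non-virtual) crossings carry their local writhe (`some ε`),
the others are precrossings (`none`). -/
structure VirtualPseudodiagram extends FlatDiagram where
  writhe : Fin n → Option ℤˣ

namespace VirtualDiagram

variable (D : VirtualDiagram)

/-- The over-strand at `c`, i.e. the tail of the arrow of `c` in the Gauss diagram.  A crossing
is positive exactly when the under-strand crosses the over-strand from right to left. -/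
def overEnd (c : Fin D.n) : D.End := (c, decide (D.writhe c = 1))

/-- The under-strand at `c`, i.e. the head of the arrow of `c` in the Gauss diagram. -/
def underEnd (c : Fin D.n) : D.End := (c, !decide (D.writhe c = 1))

/-- `x` and `y` are neighbours on the core circle: `y` directly follows `x` if `o = 1`, and
`x` directly follows `y` if `o = -1`. -/
def Neighbours (o : ℤˣ) (x y : D.End) : Prop :=
  (o = 1 ∧ D.next x = y) ∨ (o = -1 ∧ D.next y = x)

end VirtualDiagram

/-- `D` is obtained from `D'` by deleting all the chords of `D'` that are not in the range of the
injection `f` (and renaming chords along `f`): the writhes agree, and the end that follows `x` in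
`D` is the first end that one meets after `x` in `D'` and that is not deleted. -/
def IsDeletion (D D' : VirtualDiagram) (f : Fin D.n ↪ Fin D'.n) : Prop :=
  (∀ c, D'.writhe (f c) = D.writhe c) ∧
  ∀ x : D.End, ∃ k : ℕ, 0 < k ∧
    (D'.next ^ k) (f x.1, x.2) = (f (D.next x).1, (D.next x).2) ∧
    ∀ j : ℕ, 0 < j → j < k → ((D'.next ^ j) (f x.1, x.2)).1 ∉ Set.range f

/-- `D` and `D'` are the same Gauss diagram up to the names of the chords. -/
def IsRenaming (D D' : VirtualDiagram) : Prop :=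
  ∃ e : Fin D.n ≃ Fin D'.n, (∀ c, D'.writhe (e c) = D.writhe c) ∧
    ∀ x : D.End, D'.next (e x.1, x.2) = (e (D.next x).1, (D.next x).2)

/-- First Reidemeister move: `D'` has one chord more than `D`, and this chord `c` is isolated,
i.e. its two ends are neighbours on the core circle. -/
def MoveI (D D' : VirtualDiagram) : Prop :=
  ∃ (f : Fin D.n ↪ Fin D'.n) (c : Fin D'.n),
    IsDeletion D D' f ∧ (∀ d, d ∈ Set.range f ↔ d ≠ c) ∧
    ∃ s : Bool, D'.next (c, s) = (c, !s)

/-- Second Reidemeister move: `D'` has two chords `c`, `d` more than `D`; they have opposite signs,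
the two tails (over-ends) are neighbours on the core circle and so are the two heads (under-ends).
Both the case of parallel strands and the case of antiparallel strands are included. -/
def MoveII (D D' : VirtualDiagram) : Prop :=
  ∃ (f : Fin D.n ↪ Fin D'.n) (c d : Fin D'.n), c ≠ d ∧
    IsDeletion D D' f ∧ (∀ a, a ∈ Set.range f ↔ (a ≠ c ∧ a ≠ d)) ∧
    D'.writhe d = -D'.writhe c ∧
    D'.next (D'.overEnd c) = D'.overEnd d ∧
    (D'.next (D'.underEnd c) = D'.underEnd d ∨ D'.next (D'.underEnd d) = D'.underEnd c)

/-- Third Reidemeister move.  Three strands (top, middle, bottom) form a small triangle: at `a` the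
top strand passes over the middle one, at `b` the top strand passes over the bottom one, and at `c`
the middle strand passes over the bottom one.  The move keeps the signs and exchanges the two
crossings on each of the three strands.

The signs `t`, `m`, `b'` say in which order the two crossings occur on the top, middle and bottom
strand.  The two equations between signs say that the strands do form a triangle in an
oriented surface: if `u`, `v`, `w` are the directions of the strands, then the sides of the triangle
are positive multiples of `t u`, `m v`, `b' w`, with (side on top) + (side on bottom) = (side on
middle); taking determinants with `v` and with `u` gives the two equations. -/
def MoveIII (D D' : VirtualDiagram) : Prop :=
  ∃ (e : Fin D.n ≃ Fin D'.n) (a b c : Fin D.n) (t m b' : ℤˣ),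
    a ≠ b ∧ a ≠ c ∧ b ≠ c ∧
    D.Neighbours t (D.overEnd a) (D.overEnd b) ∧
    D.Neighbours m (D.underEnd a) (D.overEnd c) ∧
    D.Neighbours b' (D.underEnd b) (D.underEnd c) ∧
    t * D.writhe a = b' * D.writhe c ∧
    b' * D.writhe b = m * D.writhe a ∧
    (∀ d, D'.writhe (e d) = D.writhe d) ∧
    ∀ x : D.End,
      let σ : Equiv.Perm D.End :=
        Equiv.swap (D.overEnd a) (D.overEnd b) * Equiv.swap (D.underEnd a) (D.overEnd c) *
          Equiv.swap (D.underEnd b) (D.underEnd c)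
      D'.next (e (σ x).1, (σ x).2) = (e (σ (D.next x)).1, (σ (D.next x)).2)

/-- One step: a renaming of chords or a Reidemeister move. -/
def Move (D D' : VirtualDiagram) : Prop :=
  IsRenaming D D' ∨ MoveI D D' ∨ MoveII D D' ∨ MoveIII D D'

/-- Two diagrams represent the same (oriented) virtual knot. -/
def SameKnot (D D' : VirtualDiagram) : Prop := Relation.EqvGen Move D D'

namespace FlatDiagram

variable (S : FlatDiagram)

/-- Half-edges of the 4-valent graph with the crossings as vertices: `(x, true)` is the half-edge
that leaves the crossing at the end `x` along the orientation of the knot, `(x, false)` is the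
half-edge that arrives there. -/
abbrev HalfEdge : Type := S.End × Bool

/-- The other half of the same edge; the edges join `x` to `S.next x`. -/
def otherHalf : S.HalfEdge → S.HalfEdge
  | (x, true) => (S.next x, false)
  | (x, false) => (S.next.symm x, true)

/-- The next half-edge at the same crossing in counterclockwise order.  This order is: `true`-strand
leaving (east), `false`-strand leaving (north), `true`-strand arriving (west), `false`-strand
arriving (south). -/
def rotate : S.HalfEdge → S.HalfEdge
  | ((c, true), o) => ((c, false), o)
  | ((c, false), o) => ((c, true), !o)

/-- The faces (complementary regions) of the 4-valent graph drawn on the closed oriented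
surface that is obtained by glueing discs to the boundary curves of a thickening of the graph:
the classes of half-edges under the walk along the boundary. -/
def Face : Type := Quot fun h h' : S.HalfEdge => h' = S.rotate (S.otherHalf h)

/-- The surface carrying the diagram is a sphere, i.e. the crossings can be drawn on the sphere (or
in the plane) as prescribed, without virtual crossings.  The graph is connected with `n` vertices
and `2 n` edges, so that this means Euler characteristic `n - 2 n + (number of faces) = 2`;
a circle without crossings can always be drawn. -/
def IsPlanar : Prop := S.n = 0 ∨ Nat.card S.Face = S.n + 2

/-- The ends on the component `L₁` of the two-component link obtained by smoothing at `c` with the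
orientation: `L₁` leaves `c` along the strand `(c, true)` and runs until it is back at `c`,
where it arrives on the strand `(c, false)`. All the other ends
(apart from those of `c`) are on the other component `L₂`. -/
def OnL₁ (c : Fin S.n) (x : S.End) : Prop :=
  ∃ k : ℕ, 0 < k ∧ (S.next ^ k) (c, true) = x ∧
    ∀ j : ℕ, 0 < j → j ≤ k → (S.next ^ j) (c, true) ≠ (c, false)

open Classical in
/-- The sign of `d` as a crossing between `L₁` and `L₂`: `1` if `L₁` crosses `L₂` from left to right
at `d`, `-1` if it crosses from right to left, and `0` if `d` is a self-crossing of `L₁` or `L₂`. -/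
noncomputable def linkSign (c d : Fin S.n) : ℤ :=
  if S.OnL₁ c (d, true) ∧ ¬ S.OnL₁ c (d, false) then 1
  else if S.OnL₁ c (d, false) ∧ ¬ S.OnL₁ c (d, true) then -1
  else 0

/-- The intersection index of `c`: the virtual shadow linking number of the two components
created by smoothing at `c`. -/
noncomputable def ind (c : Fin S.n) : ℤ :=
  ∑ d ∈ Finset.univ.erase c, S.linkSign c d

/-- The set `C_m` of crossings and precrossings with intersection index `m`. -/
def C (m : ℤ) : Set (Fin S.n) := {c | S.ind c = m}

end FlatDiagram

/-- A virtual knot diagram is classical if it represents the same virtual knot as some diagram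
without virtual crossings. -/
def VirtualDiagram.IsClassical (D : VirtualDiagram) : Prop :=
  ∃ D' : VirtualDiagram, SameKnot D D' ∧ D'.IsPlanar

namespace VirtualPseudodiagram

variable (V : VirtualPseudodiagram)

/-- A virtual shadow: all (non-virtual) crossings are precrossings. -/
def IsShadow : Prop := ∀ c, V.writhe c = none

/-- The set of precrossings. -/
def precrossings : Finset (Fin V.n) := Finset.univ.filter fun c => V.writhe c = none

/-- Resolve the crossings in `T`, giving the local writhe `w c` to each `c ∈ T`. -/
def resolve (T : Finset (Fin V.n)) (w : Fin V.n → ℤˣ) : VirtualPseudodiagram where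
  toFlatDiagram := V.toFlatDiagram
  writhe c := if c ∈ T then some (w c) else V.writhe c

/-- The diagram obtained by giving the local writhe `w c` to each precrossing `c`. -/
def complete (w : Fin V.n → ℤˣ) : VirtualDiagram where
  toFlatDiagram := V.toFlatDiagram
  writhe c := (V.writhe c).getD (w c)

/-- Every way of resolving all the precrossings yields a classical knot. -/
def NecessarilyClassical : Prop := ∀ w : Fin V.n → ℤˣ, (V.complete w).IsClassical

/-- The classicalizing number: the least number of precrossings that can be resolved so that the
result is necessarily classical, and `⊤` if this is impossible. -/
noncomputable def cl : ℕ∞ :=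
  sInf {k : ℕ∞ | ∃ (T : Finset (Fin V.n)) (w : Fin V.n → ℤˣ), T ⊆ V.precrossings ∧
    (V.resolve T w).NecessarilyClassical ∧ k = (T.card : ℕ∞)}

end VirtualPseudodiagram

end VirtualKnot

/-! The proof rests on the index writhes. For `m ≠ 0`, the sum of the writhes of those crossings
whose signed index `overInd` (writhe times `ind`) equals `m` is an invariant of virtual knots, and
it vanishes on classical knots because every index of a diagram on the sphere is `0`. Suppose a
precrossing `c` with `ind c = m ≠ 0` is left unresolved. Fix all the other writhes and vary only
that of `c`. A positive `c` contributes `1` to the `m`-writhe; a negative `c` has signed index `-m ≠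
m` and contributes `0`. The two completions have different `m`-writhes, so they cannot both be
classical. Hence every precrossing of nonzero index has to be resolved.

Indices are handled through Alexander numberings (`IsPotential`): rational labels of the edges of
the core circle that jump by the sign of each end passed. By `IsPotential.ind_eq` an index is a
difference of labels at the two ends of the chord. Invariance then means carrying a numbering
through each move, and the planar case means producing a numbering from the faces. -/

namespace VirtualKnot

open Finset

/-- The sign of an end: `1` on the strand crossing from left to right, `-1` on the other one. -/
def endSign {n : ℕ} (x : Fin n × Bool) : ℚ := if x.2 then 1 else -1

@[simp] lemma endSign_true {n : ℕ} (c : Fin n) : endSign (c, true) = 1 := rfl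

@[simp] lemma endSign_false {n : ℕ} (c : Fin n) : endSign (c, false) = -1 := rfl

lemma sum_endSign (n : ℕ) : ∑ x : Fin n × Bool, endSign x = 0 := by
  simp [Fintype.sum_prod_type]

/-! ### Alexander numberings of the core circle. -/

namespace FlatDiagram

variable (S : FlatDiagram)

lemma eq_of_next_eq {S : FlatDiagram} {α : Type*} {G : S.End → α}
    (h : ∀ x, G (S.next x) = G x) (x y : S.End) : G x = G y := by
  obtain ⟨i, -, hi⟩ := (S.single_circle x y).exists_pow_eq'
  have key : ∀ k : ℕ, G ((S.next ^ k) x) = G x := by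
    intro k
    induction k with
    | zero => rfl
    | succ k ih => rw [pow_succ', Equiv.Perm.mul_apply, h, ih]
  rw [← hi, key]

/-- An Alexander numbering of the core circle: it changes by the sign of each end that is
passed. -/
def IsPotential (P : S.End → ℚ) : Prop :=
  ∀ x, P (S.next x) = P x + endSign (S.next x)

lemma sum_next (g : S.End → ℚ) : ∑ x, g (S.next x) = ∑ x, g x :=
  Equiv.sum_comp S.next g

/-- A function on the ends with vanishing sum is a difference along the circle. -/
lemma exists_next_sub {g : S.End → ℚ} (hg : ∑ x, g x = 0) :
    ∃ P : S.End → ℚ, ∀ x, P (S.next x) - P x = g x := by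
  rcases isEmpty_or_nonempty S.End with hE | ⟨⟨x₀⟩⟩
  · exact ⟨0, fun x => (hE.false x).elim⟩
  have : Nonempty S.End := ⟨x₀⟩
  -- The extra constant fills the one-dimensional cokernel of the difference operator, so
  -- rank-nullity makes `L` surjective. Summing around the circle then forces the constant to vanish
  -- when the target has sum zero.
  let L : (S.End → ℚ) × ℚ →ₗ[ℚ] (S.End → ℚ) :=
    { toFun := fun p x => p.1 (S.next x) - p.1 x + p.2
      map_add' := by intro p q; ext x; simp; ring
      map_smul' := by intro r p; ext x; simp; ring }
  have hsum : ∀ p, ∑ x, L p x = Fintype.card S.End * p.2 := by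
    intro p
    simp only [L, LinearMap.coe_mk, AddHom.coe_mk, sum_add_distrib, sum_sub_distrib]
    rw [S.sum_next p.1]
    simp
  have hcard : (Fintype.card S.End : ℚ) ≠ 0 := by
    exact_mod_cast Fintype.card_ne_zero
  have hker : Module.finrank ℚ (LinearMap.ker L) ≤ 1 := by
    let ev : LinearMap.ker L →ₗ[ℚ] ℚ :=
      { toFun := fun p => p.1.1 x₀
        map_add' := by intro p q; simp
        map_smul' := by intro r p; simp }
    have hev : Function.Injective ev := by
      rw [injective_iff_map_eq_zero]
      rintro ⟨p, hp⟩ h0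
      have hp' : L p = 0 := hp
      have h2 : p.2 = 0 := by
        have := hsum p
        rw [hp'] at this
        simpa using (mul_eq_zero.1 (this.symm.trans (by simp))).resolve_left hcard
      have h1 : ∀ x, p.1 (S.next x) = p.1 x := by
        intro x
        have := congrFun hp' x
        simp only [L, LinearMap.coe_mk, AddHom.coe_mk, h2, Pi.zero_apply] at this
        linarith
      ext x
      · exact (eq_of_next_eq h1 x x₀).trans h0
      · exact h2
    simpa using LinearMap.finrank_le_finrank_of_injective hev
  have hrange : LinearMap.range L = ⊤ := by
    apply Submodule.eq_top_of_finrank_eq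
    have h1 := LinearMap.finrank_range_add_finrank_ker L
    have h2 := Submodule.finrank_le (LinearMap.range L)
    simp only [Module.finrank_prod, Module.finrank_fintype_fun_eq_card,
      Module.finrank_self] at h1 h2 ⊢
    omega
  obtain ⟨p, hp⟩ := LinearMap.range_eq_top.1 hrange g
  have h2 : p.2 = 0 := by
    have := hsum p
    rw [hp, hg] at this
    exact (mul_eq_zero.1 this.symm).resolve_left hcard
  refine ⟨p.1, fun x => ?_⟩
  have := congrFun hp x
  simp only [L, LinearMap.coe_mk, AddHom.coe_mk, h2] at this
  linarith

/-- The two ends of a chord have opposite signs, so the jumps around the circle add up to zero. -/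
lemma exists_isPotential : ∃ P, S.IsPotential P := by
  obtain ⟨P, hP⟩ := S.exists_next_sub (g := fun x => endSign (S.next x))
    (by rw [S.sum_next endSign, sum_endSign])
  exact ⟨P, fun x => by linarith [hP x]⟩

/-! ### The smoothing at a crossing, and the index as a difference of labels. -/

/-- The edges, named by their starting ends, of the component `L₁` of the smoothing at `c`. -/
def EdgeOnL₁ (c : Fin S.n) (x : S.End) : Prop :=
  ∃ k : ℕ, (S.next ^ k) (c, true) = x ∧ ∀ j ≤ k, (S.next ^ j) (c, true) ≠ (c, false)

section EdgeOnL₁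

variable {S} {c : Fin S.n}

lemma edgeOnL₁_true : S.EdgeOnL₁ c (c, true) := by
  refine ⟨0, rfl, fun j hj => ?_⟩
  obtain rfl : j = 0 := by omega
  simp

lemma not_edgeOnL₁_false : ¬ S.EdgeOnL₁ c (c, false) := by
  rintro ⟨k, hk, h⟩
  exact h k le_rfl hk

lemma onL₁_of_edgeOnL₁ {x : S.End} (h : S.EdgeOnL₁ c x) (hx : x ≠ (c, true)) :
    S.OnL₁ c x := by
  obtain ⟨k, hk, h⟩ := h
  refine ⟨k, Nat.pos_of_ne_zero ?_, hk, fun j _ hj => h j hj⟩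
  rintro rfl
  exact hx hk.symm

lemma edgeOnL₁_of_onL₁ {x : S.End} (h : S.OnL₁ c x) : S.EdgeOnL₁ c x := by
  obtain ⟨k, -, hk, h⟩ := h
  refine ⟨k, hk, fun j hj => ?_⟩
  rcases Nat.eq_zero_or_pos j with rfl | hj0
  · simp
  · exact h j hj0 hj

lemma edgeOnL₁_next_iff {x : S.End} (hx : (S.next x).1 ≠ c) :
    S.EdgeOnL₁ c (S.next x) ↔ S.EdgeOnL₁ c x := by
  constructor
  · rintro ⟨k, hk, h⟩
    cases k with
    | zero => exact absurd (congrArg Prod.fst hk).symm hx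
    | succ k =>
      rw [pow_succ', Equiv.Perm.mul_apply] at hk
      exact ⟨k, S.next.injective hk, fun j hj => h j (by omega)⟩
  · rintro ⟨k, hk, h⟩
    refine ⟨k + 1, by rw [pow_succ', Equiv.Perm.mul_apply, hk], fun j hj => ?_⟩
    rcases Nat.lt_or_ge k j with h1 | h1
    · obtain rfl : j = k + 1 := by omega
      rw [pow_succ', Equiv.Perm.mul_apply, hk]
      exact fun h2 => hx (congrArg Prod.fst h2)
    · exact h j h1

lemma edgeOnL₁_of_next_eq_false {x : S.End} (hx : S.next x = (c, false)) :
    S.EdgeOnL₁ c x := by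
  classical
  have hex : ∃ k : ℕ, (S.next ^ k) (c, true) = (c, false) := by
    obtain ⟨i, -, hi⟩ := (S.single_circle (c, true) (c, false)).exists_pow_eq'
    exact ⟨i, hi⟩
  have hspec := Nat.find_spec hex
  have hmin : ∀ j, j < Nat.find hex → _ := fun j => Nat.find_min hex (m := j)
  cases hk : Nat.find hex with
  | zero => rw [hk] at hspec; simp at hspec
  | succ k =>
    rw [hk] at hspec hmin
    rw [pow_succ', Equiv.Perm.mul_apply, ← hx] at hspec
    exact ⟨k, S.next.injective hspec, fun j hj => hmin j (by omega)⟩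

/-- Otherwise the walk from `(c, true)` would close up before meeting `(c, false)` and so never meet
it, although all ends lie on one circle. -/
lemma not_edgeOnL₁_of_next_eq_true {x : S.End} (hx : S.next x = (c, true)) :
    ¬ S.EdgeOnL₁ c x := by
  rintro ⟨k, hk, h⟩
  have hper : (S.next ^ (k + 1)) (c, true) = (c, true) := by
    rw [pow_succ', Equiv.Perm.mul_apply, hk, hx]
  obtain ⟨i, -, hi⟩ := (S.single_circle (c, true) (c, false)).exists_pow_eq'
  apply h (i % (k + 1)) (Nat.lt_succ_iff.1 (Nat.mod_lt _ (Nat.succ_pos _)))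
  rw [← hi]
  conv_rhs => rw [← Nat.mod_add_div i (k + 1), pow_add, Equiv.Perm.mul_apply, pow_mul]
  congr 1
  symm
  generalize i / (k + 1) = q
  induction q with
  | zero => rfl
  | succ q ih => rw [pow_succ, Equiv.Perm.mul_apply, hper, ih]

end EdgeOnL₁

/-- The intersection index is read off from any Alexander numbering. -/
lemma IsPotential.ind_eq {S : FlatDiagram} {P : S.End → ℚ} (hP : S.IsPotential P)
    (c : Fin S.n) : (S.ind c : ℚ) = P (c, false) + 1 - P (c, true) := by
  classical
  -- Summation by parts: the jumps `g` of `u * P` add up to zero around the circle. Away from `c`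
  -- the indicator `u` does not jump, and the two ends of `d` together give `linkSign c d`; at `c`
  -- the arc starts and stops, which leaves the boundary terms.
  let u : S.End → ℚ := fun x => if S.EdgeOnL₁ c x then 1 else 0
  have hz : ∑ x, (u (S.next x) * P (S.next x) - u x * P x) = 0 := by
    rw [sum_sub_distrib, S.sum_next fun x => u x * P x, sub_self]
  let g : S.End → ℚ := fun y => u y * P y - u (S.next.symm y) * P (S.next.symm y)
  have hg : ∑ y, g y = 0 := by
    rw [← S.sum_next g, ← hz]
    simp [g]
  have hpred : ∀ y, P (S.next.symm y) = P y - endSign y := by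
    intro y
    have := hP (S.next.symm y)
    rw [Equiv.apply_symm_apply] at this
    linarith
  have hgT : g (c, true) = P (c, true) := by
    have h1 := not_edgeOnL₁_of_next_eq_true (S.next.apply_symm_apply (c, true))
    simp [g, u, h1, edgeOnL₁_true]
  have hgF : g (c, false) = - (P (c, false) + 1) := by
    have h1 := edgeOnL₁_of_next_eq_false (S.next.apply_symm_apply (c, false))
    simp [g, u, h1, not_edgeOnL₁_false, hpred]
  have hother : ∀ y : S.End, y.1 ≠ c → g y = u y * endSign y := by
    intro y hy
    have h1 : S.EdgeOnL₁ c y ↔ S.EdgeOnL₁ c (S.next.symm y) := by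
      simpa using edgeOnL₁_next_iff (c := c) (x := S.next.symm y) (by simpa using hy)
    simp only [g, u, hpred, ← h1]
    ring
  have honL : ∀ y : S.End, y.1 ≠ c → (S.OnL₁ c y ↔ S.EdgeOnL₁ c y) := fun y hy =>
    ⟨edgeOnL₁_of_onL₁, fun h => onL₁_of_edgeOnL₁ h fun h' => hy (congrArg Prod.fst h')⟩
  have hlink : ∀ d ∈ univ.erase c, (S.linkSign c d : ℚ) = g (d, true) + g (d, false) := by
    intro d hd
    have hd' : d ≠ c := ne_of_mem_erase hd
    rw [hother _ hd', hother _ hd']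
    simp only [linkSign, honL (d, true) hd', honL (d, false) hd', u]
    by_cases h1 : S.EdgeOnL₁ c (d, true) <;> by_cases h2 : S.EdgeOnL₁ c (d, false) <;>
      simp [h1, h2]
  have hsplit : ∑ y, g y = (g (c, true) + g (c, false)) + (S.ind c : ℚ) := by
    rw [Fintype.sum_prod_type, ind, Int.cast_sum, sum_congr rfl hlink]
    simp only [Fintype.sum_bool]
    rw [← add_sum_erase univ _ (mem_univ c)]
  rw [hg, hgT, hgF] at hsplit
  linarith

/-! ### Faces, and the vanishing of indices on the sphere. -/

section Planar

variable (S : FlatDiagram)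

/-- The face to the right of the edge from `x` to `S.next x`. -/
def rightFace (x : S.End) : S.Face := Quot.mk _ (x, true)

/-- The face to the left of the edge from `x` to `S.next x`. -/
def leftFace (x : S.End) : S.Face := Quot.mk _ (S.next x, false)

variable {S}

lemma face_eq (h : S.HalfEdge) :
    (Quot.mk _ h : S.Face) = Quot.mk _ (S.rotate (S.otherHalf h)) :=
  Quot.sound rfl

lemma rightFace_of_next_true {x : S.End} {d : Fin S.n} (hx : S.next x = (d, true)) :
    S.rightFace x = S.leftFace (S.next.symm (d, false)) := by
  rw [rightFace, leftFace, face_eq, otherHalf, hx, Equiv.apply_symm_apply, rotate]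

lemma rightFace_of_next_false {x : S.End} {d : Fin S.n} (hx : S.next x = (d, false)) :
    S.rightFace x = S.rightFace (d, true) := by
  rw [rightFace, rightFace, face_eq, otherHalf, hx, rotate, Bool.not_false]

lemma leftFace_true (d : Fin S.n) : S.leftFace (d, true) = S.rightFace (d, false) := by
  rw [rightFace, leftFace, face_eq, otherHalf, Equiv.symm_apply_apply, rotate]

lemma leftFace_false (d : Fin S.n) :
    S.leftFace (d, false) = S.leftFace (S.next.symm (d, true)) := by
  rw [leftFace, leftFace, face_eq, otherHalf, Equiv.symm_apply_apply, Equiv.apply_symm_apply,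
    rotate, Bool.not_true]

/-- The dual graph is connected. -/
lemma eq_of_leftFace_eq_rightFace {φ : S.Face → ℚ}
    (h : ∀ x, φ (S.leftFace x) = φ (S.rightFace x)) (F F' : S.Face) : φ F = φ F' := by
  have hnext : ∀ x, φ (S.rightFace (S.next x)) = φ (S.rightFace x) := by
    intro x
    obtain ⟨⟨d, b⟩, hy⟩ : ∃ y, S.next x = y := ⟨_, rfl⟩
    rw [hy]
    cases b
    · rw [rightFace_of_next_false hy, ← leftFace_true, h]
    · rw [rightFace_of_next_true hy, h,
        rightFace_of_next_false (S.next.apply_symm_apply (d, false))]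
  have hcast : ∀ F : S.Face, ∃ x, φ F = φ (S.rightFace x) := by
    rintro ⟨⟨x, b⟩⟩
    cases b
    · refine ⟨S.next.symm x, ?_⟩
      rw [← h, leftFace, Equiv.apply_symm_apply]
    · exact ⟨x, rfl⟩
  obtain ⟨x, hx⟩ := hcast F
  obtain ⟨y, hy⟩ := hcast F'
  rw [hx, hy]
  exact eq_of_next_eq (G := fun x => φ (S.rightFace x)) hnext x y

/-- The coboundary of a function on the faces is a cycle. -/
lemma face_vertex_orthogonal (φ : S.Face → ℚ) (h : Fin S.n → ℚ) :
    ∑ x, (φ (S.leftFace x) - φ (S.rightFace x)) * (h (S.next x).1 - h x.1) = 0 := by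
  let a : S.End → ℚ := fun x => φ (S.leftFace x) - φ (S.rightFace x)
  have h1 : ∑ x, a x * h (S.next x).1 = ∑ y, a (S.next.symm y) * h y.1 := by
    rw [← S.sum_next fun y => a (S.next.symm y) * h y.1]
    simp
  have h2 : ∑ x, a x * (h (S.next x).1 - h x.1) =
      ∑ y : S.End, (a (S.next.symm y) - a y) * h y.1 := by
    simp only [mul_sub, sub_mul, sum_sub_distrib, h1]
  -- After summation by parts it remains to see that at each crossing the four jumps between
  -- consecutive faces cancel.
  rw [h2, Fintype.sum_prod_type]
  refine sum_eq_zero fun d _ => ?_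
  have e1 := rightFace_of_next_true (S.next.apply_symm_apply (d, true))
  have e2 := rightFace_of_next_false (S.next.apply_symm_apply (d, false))
  simp only [Fintype.sum_bool, a, e1, e2, leftFace_true, leftFace_false]
  ring

/-- On the sphere the knot is a boundary, i.e. its complementary regions can be numbered. -/
lemma exists_face_numbering (hn : S.n ≠ 0) (hF : Nat.card S.Face = S.n + 2) :
    ∃ φ : S.Face → ℚ, ∀ x, φ (S.leftFace x) - φ (S.rightFace x) = 1 := by
  have : Finite S.Face := Nat.finite_of_card_ne_zero (by omega)
  have := Fintype.ofFinite S.Face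
  rw [Nat.card_eq_fintype_card] at hF
  let c₀ : Fin S.n := ⟨0, by omega⟩
  let F₀ : S.Face := S.rightFace (c₀, true)
  -- A discrete Hodge decomposition. The face and vertex coboundaries are orthogonal, so the kernel
  -- consists of pairs of constants. The source has dimension `(n + 2) + n` and the target `2 n`, so
  -- `L` is onto: the sphere has no first homology.
  let L : (S.Face → ℚ) × (Fin S.n → ℚ) →ₗ[ℚ] (S.End → ℚ) :=
    { toFun := fun p x => (p.1 (S.leftFace x) - p.1 (S.rightFace x)) +
        (p.2 (S.next x).1 - p.2 x.1)
      map_add' := by intro p q; ext x; simp; ring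
      map_smul' := by intro r p; ext x; simp; ring }
  have hL : ∀ p x, L p x = (p.1 (S.leftFace x) - p.1 (S.rightFace x)) +
        (p.2 (S.next x).1 - p.2 x.1) := fun _ _ => rfl
  have hker : Module.finrank ℚ (LinearMap.ker L) ≤ 2 := by
    let ev : LinearMap.ker L →ₗ[ℚ] ℚ × ℚ :=
      { toFun := fun p => (p.1.1 F₀, p.1.2 c₀)
        map_add' := by intro p q; simp
        map_smul' := by intro r p; simp }
    have hev : Function.Injective ev := by
      rw [injective_iff_map_eq_zero]
      rintro ⟨p, hp⟩ h0
      have hp' : L p = 0 := hp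
      have hv : ∀ x : S.End, p.2 (S.next x).1 - p.2 x.1 = 0 := by
        have hsq : ∑ x : S.End, (p.2 (S.next x).1 - p.2 x.1) ^ 2 = 0 := by
          have h1 : ∀ x : S.End, (p.2 (S.next x).1 - p.2 x.1) ^ 2 =
              - ((p.1 (S.leftFace x) - p.1 (S.rightFace x)) *
                (p.2 (S.next x).1 - p.2 x.1)) := by
            intro x
            have h2 := (hL p x).symm.trans (congrFun hp' x)
            simp only [Pi.zero_apply] at h2
            linear_combination (p.2 (S.next x).1 - p.2 x.1) * h2
          rw [sum_congr rfl fun x _ => h1 x, sum_neg_distrib, face_vertex_orthogonal, neg_zero]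
        intro x
        have := (sum_eq_zero_iff_of_nonneg fun x _ => sq_nonneg _).1 hsq x (mem_univ x)
        exact pow_eq_zero_iff two_ne_zero |>.1 this
      have hf : ∀ x, p.1 (S.leftFace x) = p.1 (S.rightFace x) := by
        intro x
        have h2 := (hL p x).symm.trans (congrFun hp' x)
        rw [hv, add_zero] at h2
        exact sub_eq_zero.1 h2
      have h0' := Prod.ext_iff.1 h0
      ext i
      · exact (eq_of_leftFace_eq_rightFace hf i F₀).trans h0'.1
      · exact (eq_of_next_eq (G := fun x : S.End => p.2 x.1)
          (fun x => sub_eq_zero.1 (hv x)) (i, true) (c₀, true)).trans h0'.2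
    simpa [Module.finrank_prod] using LinearMap.finrank_le_finrank_of_injective hev
  have hrange : LinearMap.range L = ⊤ := by
    apply Submodule.eq_top_of_finrank_eq
    have h1 := LinearMap.finrank_range_add_finrank_ker L
    have h2 := Submodule.finrank_le (LinearMap.range L)
    simp only [Module.finrank_prod, Module.finrank_fintype_fun_eq_card, hF,
      Fintype.card_prod, Fintype.card_fin, Fintype.card_bool] at h1 h2 ⊢
    omega
  -- The constant `1` is the knot itself as a cycle. It is orthogonal to the vertex coboundaries by
  -- telescoping, so its vertex part has square sum zero and only the face part remains.
  obtain ⟨p, hp⟩ := LinearMap.range_eq_top.1 hrange fun _ => 1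
  have hp' : ∀ x, p.1 (S.leftFace x) - p.1 (S.rightFace x) =
      1 - (p.2 (S.next x).1 - p.2 x.1) := by
    intro x
    have := (hL p x).symm.trans (congrFun hp x)
    linarith
  have horth := face_vertex_orthogonal p.1 p.2
  simp only [hp', sub_mul, one_mul, sum_sub_distrib, S.sum_next fun x => p.2 x.1, sub_self,
    zero_sub, neg_eq_zero] at horth
  refine ⟨p.1, fun x => ?_⟩
  have hsq : ∑ x : S.End, (p.2 (S.next x).1 - p.2 x.1) ^ 2 = 0 := by
    rw [← horth, ← sum_sub_distrib]
    exact sum_congr rfl fun x _ => by ring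
  have := (sum_eq_zero_iff_of_nonneg fun x _ => sq_nonneg _).1 hsq x (mem_univ x)
  rw [hp', pow_eq_zero_iff two_ne_zero |>.1 this, sub_zero]

/-- All indices of a diagram on the sphere vanish. -/
lemma IsPlanar.ind_eq_zero (hS : S.IsPlanar) (c : Fin S.n) : S.ind c = 0 := by
  rcases hS with h0 | hF
  · exact absurd c.2 (by omega)
  obtain ⟨φ, hφ⟩ := exists_face_numbering (by have := c.2; omega) hF
  -- Passing an end moves the face on the right across the other strand, whose direction determines
  -- the sign of the jump.
  have hP : S.IsPotential fun x => - φ (S.rightFace x) := by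
    intro x
    obtain ⟨⟨d, b⟩, hy⟩ : ∃ y, S.next x = y := ⟨_, rfl⟩
    have e2 := rightFace_of_next_false (S.next.apply_symm_apply (d, false))
    rw [hy]
    beta_reduce
    cases b
    · have := hφ (d, true)
      rw [leftFace_true] at this
      rw [rightFace_of_next_false hy, endSign_false]
      linarith
    · have := hφ (S.next.symm (d, false))
      rw [e2] at this
      rw [rightFace_of_next_true hy, endSign_true]
      linarith
  have h1 := hP.ind_eq c
  have h2 := hφ (c, true)
  rw [leftFace_true] at h2
  have h3 : (S.ind c : ℚ) = 0 := by linarith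
  exact_mod_cast h3

end Planar

end FlatDiagram

/-! ### Index writhes and their invariance under the moves. -/

namespace VirtualDiagram

open FlatDiagram

/-- The index of a crossing as computed on the arc from the over- to the under-strand. -/
noncomputable def overInd (D : VirtualDiagram) (c : Fin D.n) : ℤ := D.writhe c * D.ind c

/-- The `m`-writhe: the sum of the signs of the crossings with index `m`. -/
noncomputable def indexWrithe (D : VirtualDiagram) (m : ℤ) : ℤ :=
  ∑ c, if D.overInd c = m then (D.writhe c : ℤ) else 0

variable {D D' : VirtualDiagram}

lemma endSign_overEnd (c : Fin D.n) : endSign (D.overEnd c) = ((D.writhe c : ℤ) : ℚ) := by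
  rcases Int.units_eq_one_or (D.writhe c) with h | h <;> simp [overEnd, endSign, h]

lemma endSign_underEnd (c : Fin D.n) : endSign (D.underEnd c) = -((D.writhe c : ℤ) : ℚ) := by
  rcases Int.units_eq_one_or (D.writhe c) with h | h <;> simp [underEnd, endSign, h]

/-- The `true` strand is the over-strand exactly at a positive crossing, so the factor `writhe`
turns the two forms of `ind_eq` into one formula in over- and under-ends. -/
lemma overInd_eq {P : D.End → ℚ} (hP : D.IsPotential P) (c : Fin D.n) :
    (D.overInd c : ℚ) = P (D.underEnd c) - P (D.overEnd c) + (D.writhe c : ℤ) := by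
  have := hP.ind_eq c
  rcases Int.units_eq_one_or (D.writhe c) with h | h <;>
    simp [overInd, underEnd, overEnd, h, this] <;> ring

lemma overInd_eq_overInd {P : D.End → ℚ} (hP : D.IsPotential P) {P' : D'.End → ℚ}
    (hP' : D'.IsPotential P') {c : Fin D.n} {c' : Fin D'.n} (hw : D'.writhe c' = D.writhe c)
    (h : P' (D'.underEnd c') - P' (D'.overEnd c') = P (D.underEnd c) - P (D.overEnd c)) :
    D'.overInd c' = D.overInd c := by
  have h1 : (D'.overInd c' : ℚ) = D.overInd c := by
    rw [overInd_eq hP, overInd_eq hP', h, hw]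
  exact_mod_cast h1

lemma indexWrithe_eq_of_equiv (e : Fin D.n ≃ Fin D'.n) (hw : ∀ c, D'.writhe (e c) = D.writhe c)
    (hi : ∀ c, D'.overInd (e c) = D.overInd c) (m : ℤ) :
    D.indexWrithe m = D'.indexWrithe m := by
  rw [indexWrithe, indexWrithe, ← Equiv.sum_comp e]
  simp only [hw, hi]

lemma overEnd_of_writhe_eq {c : Fin D.n} {c' : Fin D'.n} (hw : D'.writhe c' = D.writhe c) :
    D'.overEnd c' = (c', (D.overEnd c).2) := by
  simp [overEnd, hw]

lemma underEnd_of_writhe_eq {c : Fin D.n} {c' : Fin D'.n} (hw : D'.writhe c' = D.writhe c) :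
    D'.underEnd c' = (c', (D.underEnd c).2) := by
  simp [underEnd, hw]

lemma indexWrithe_eq_of_isRenaming (h : IsRenaming D D') (m : ℤ) :
    D.indexWrithe m = D'.indexWrithe m := by
  obtain ⟨e, hw, hnext⟩ := h
  obtain ⟨P, hP⟩ := D'.exists_isPotential
  refine indexWrithe_eq_of_equiv e hw (fun c => ?_) m
  have hP' : D.IsPotential fun x => P (e x.1, x.2) := by
    intro x
    have := hP (e x.1, x.2)
    rw [hnext] at this
    exact this
  refine overInd_eq_overInd hP' hP (hw c) ?_
  rw [overEnd_of_writhe_eq (hw c), underEnd_of_writhe_eq (hw c)]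
  rfl

/-- Deleting chords whose ends come in cancelling adjacent pairs preserves Alexander numberings. -/
lemma isPotential_of_isDeletion {f : Fin D.n ↪ Fin D'.n} (h : IsDeletion D D' f)
    {P : D'.End → ℚ} (hP : D'.IsPotential P) (A : Set D'.End)
    (hdel : ∀ x : D'.End, x.1 ∉ Set.range f ↔ x ∈ A ∨ D'.next.symm x ∈ A)
    (hdisj : ∀ x ∈ A, D'.next x ∉ A)
    (hsign : ∀ x ∈ A, endSign (D'.next x) = - endSign x) :
    D.IsPotential fun x => P (f x.1, x.2) := by
  classical
  -- `A` holds the first end of each cancelling pair. Undoing the jump there makes `Q` constant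
  -- across the whole pair, so `Q` sees only the surviving ends.
  let Q : D'.End → ℚ := fun x => if x ∈ A then P x - endSign x else P x
  have hQkeep : ∀ x : D.End, Q (f x.1, x.2) = P (f x.1, x.2) := by
    intro x
    have : ((f x.1, x.2) : D'.End) ∉ A := fun hx => (hdel _).2 (Or.inl hx) ⟨x.1, rfl⟩
    simp [Q, this]
  have hQdel : ∀ x : D'.End, (D'.next x).1 ∉ Set.range f → Q (D'.next x) = Q x := by
    intro x hx
    rcases (hdel _).1 hx with h1 | h1
    · have h2 : x ∉ A := fun h2 => hdisj x h2 h1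
      simp [Q, h1, h2, hP x]
    · rw [Equiv.symm_apply_apply] at h1
      simp [Q, h1, hdisj x h1, hP x, hsign x h1, sub_eq_add_neg]
  have hQnext : ∀ x : D'.End, (D'.next x).1 ∈ Set.range f →
      Q (D'.next x) = Q x + endSign (D'.next x) := by
    intro x hx
    have h1 : D'.next x ∉ A := fun h1 => (hdel _).2 (Or.inl h1) hx
    have h2 : x ∉ A := fun h2 =>
      (hdel (D'.next x)).2 (Or.inr (by rwa [Equiv.symm_apply_apply])) hx
    simp [Q, h1, h2, hP x]
  intro x
  obtain ⟨k, hk, hkx, hj⟩ := h.2 x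
  have hQj : ∀ j, j < k → Q ((D'.next ^ j) (f x.1, x.2)) = Q (f x.1, x.2) := by
    intro j
    induction j with
    | zero => intro _; rfl
    | succ j ih =>
      intro hjk
      have h1 := hj (j + 1) (Nat.succ_pos j) hjk
      rw [pow_succ', Equiv.Perm.mul_apply] at h1 ⊢
      rw [hQdel _ h1, ih (by omega)]
  obtain ⟨j, rfl⟩ : ∃ j, k = j + 1 := ⟨k - 1, by omega⟩
  rw [pow_succ', Equiv.Perm.mul_apply] at hkx
  have h1 := hQnext ((D'.next ^ j) (f x.1, x.2)) (by rw [hkx]; exact ⟨_, rfl⟩)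
  rw [hkx, hQj j (by omega), hQkeep, hQkeep] at h1
  exact h1

lemma overInd_of_isPotential_comp {f : Fin D.n ↪ Fin D'.n}
    (hw : ∀ c, D'.writhe (f c) = D.writhe c) {P : D'.End → ℚ} (hP : D'.IsPotential P)
    (hP' : D.IsPotential fun x => P (f x.1, x.2)) (c : Fin D.n) :
    D'.overInd (f c) = D.overInd c := by
  refine overInd_eq_overInd hP' hP (hw c) ?_
  rw [overEnd_of_writhe_eq (hw c), underEnd_of_writhe_eq (hw c)]
  rfl

/-- The sum over all crossings of `D'` splits into those kept in `D` and those deleted. -/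
lemma indexWrithe_eq_add_of_embedding (f : Fin D.n ↪ Fin D'.n) (s : Finset (Fin D'.n))
    (hs : ∀ a, a ∈ Set.range f ↔ a ∉ s)
    (hw : ∀ c, D'.writhe (f c) = D.writhe c) (hi : ∀ c, D'.overInd (f c) = D.overInd c) (m : ℤ) :
    D'.indexWrithe m = D.indexWrithe m +
      ∑ a ∈ s, if D'.overInd a = m then (D'.writhe a : ℤ) else 0 := by
  have hcompl : sᶜ = univ.map f := by
    ext a
    rw [mem_compl, ← hs]
    simp
  rw [indexWrithe, ← sum_compl_add_sum s, hcompl, sum_map]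
  simp only [hw, hi, indexWrithe]

/-- The isolated chord has index `0`, so it affects only the `0`-writhe; this is the one move that
needs `m ≠ 0`. -/
lemma indexWrithe_eq_of_moveI (h : MoveI D D') {m : ℤ} (hm : m ≠ 0) :
    D.indexWrithe m = D'.indexWrithe m := by
  obtain ⟨f, c, hdel, hrange, s, hs⟩ := h
  obtain ⟨P, hP⟩ := D'.exists_isPotential
  have hsign : endSign (c, !s) = - endSign (c, s) := by cases s <;> simp
  have hP' : D.IsPotential fun x => P (f x.1, x.2) := by
    refine isPotential_of_isDeletion hdel hP {(c, s)} ?_ ?_ ?_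
    · rintro ⟨a, b⟩
      rw [hrange, Set.mem_singleton_iff, Set.mem_singleton_iff, Equiv.symm_apply_eq, hs]
      cases b <;> cases s <;> simp
    · rintro x rfl
      rw [hs]
      simp
    · rintro x rfl
      rw [hs, hsign]
  have hc : D'.overInd c = 0 := by
    have h1 := hP.ind_eq c
    have h2 := hP (c, s)
    rw [hs] at h2
    have h3 : (D'.ind c : ℚ) = 0 := by
      rw [h1]
      cases s <;> simp at h2 <;> linarith
    rw [overInd, Int.cast_eq_zero.1 h3, mul_zero]
  rw [indexWrithe_eq_add_of_embedding f {c} (by simpa using hrange) hdel.1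
    (overInd_of_isPotential_comp hdel.1 hP hP')]
  simp [hc, hm.symm]

lemma eq_overEnd_or_eq_underEnd (x : D.End) : x = D.overEnd x.1 ∨ x = D.underEnd x.1 := by
  obtain ⟨c, b⟩ := x
  simp only [overEnd, underEnd, Prod.mk.injEq, true_and]
  cases b <;> cases decide (D.writhe c = 1) <;> simp

lemma overEnd_ne_underEnd (c d : Fin D.n) : D.overEnd c ≠ D.underEnd d := by
  intro h
  obtain rfl : c = d := congrArg Prod.fst h
  simp [overEnd, underEnd] at h

lemma overEnd_injective : Function.Injective D.overEnd := fun _ _ h => congrArg Prod.fst h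

lemma underEnd_injective : Function.Injective D.underEnd := fun _ _ h => congrArg Prod.fst h

lemma fst_eq_iff (x : D.End) (c : Fin D.n) :
    x.1 = c ↔ x = D.overEnd c ∨ x = D.underEnd c := by
  constructor
  · rintro rfl
    exact eq_overEnd_or_eq_underEnd x
  · rintro (rfl | rfl) <;> rfl

/-- The two deleted crossings have equal `overInd` and opposite writhes, so they cancel for every
`m`; the other indices survive because adjacent deleted ends have opposite signs. -/
lemma indexWrithe_eq_of_moveII (h : MoveII D D') (m : ℤ) :
    D.indexWrithe m = D'.indexWrithe m := by
  obtain ⟨f, c, d, hcd, hdel, hrange, hw, hover, hunder⟩ := h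
  obtain ⟨P, hP⟩ := D'.exists_isPotential
  have hwq : ((D'.writhe d : ℤ) : ℚ) = -((D'.writhe c : ℤ) : ℚ) := by rw [hw]; simp
  have hdel' : ∀ x : D'.End, x.1 ∉ Set.range f ↔
      (x = D'.overEnd c ∨ x = D'.underEnd c) ∨ (x = D'.overEnd d ∨ x = D'.underEnd d) := by
    intro x
    rw [hrange, ← fst_eq_iff, ← fst_eq_iff]
    tauto
  have ho := overEnd_injective.ne hcd
  have hu := underEnd_injective.ne hcd
  have hou := overEnd_ne_underEnd (D := D')
  have hP' : D.IsPotential fun x => P (f x.1, x.2) := by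
    rcases hunder with hunder | hunder
    · refine isPotential_of_isDeletion hdel hP {D'.overEnd c, D'.underEnd c} ?_ ?_ ?_
      · intro x
        rw [hdel']
        simp only [Set.mem_insert_iff, Set.mem_singleton_iff, Equiv.symm_apply_eq, hover, hunder]
      · rintro x (rfl | rfl)
        · simp [hover, ho.symm, hou]
        · simp [hunder, hu.symm, (hou _ _).symm]
      · rintro x (rfl | rfl)
        · rw [hover, endSign_overEnd, endSign_overEnd, hwq]
        · rw [hunder, endSign_underEnd, endSign_underEnd, hwq]
    · refine isPotential_of_isDeletion hdel hP {D'.overEnd c, D'.underEnd d} ?_ ?_ ?_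
      · intro x
        rw [hdel']
        simp only [Set.mem_insert_iff, Set.mem_singleton_iff, Equiv.symm_apply_eq, hover, hunder]
        tauto
      · rintro x (rfl | rfl)
        · simp [hover, ho.symm, hou]
        · simp [hunder, hu, (hou _ _).symm]
      · rintro x (rfl | rfl)
        · rw [hover, endSign_overEnd, endSign_overEnd, hwq]
        · rw [hunder, endSign_underEnd, endSign_underEnd, hwq, neg_neg]
  have hind : D'.overInd d = D'.overInd c := by
    have h1 := hP (D'.overEnd c)
    rw [hover, endSign_overEnd, hwq] at h1
    have h2 : P (D'.underEnd d) = P (D'.underEnd c) + (D'.writhe c : ℤ) := by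
      rcases hunder with hunder | hunder
      · have h2 := hP (D'.underEnd c)
        rw [hunder, endSign_underEnd, hwq] at h2
        linarith
      · have h2 := hP (D'.underEnd d)
        rw [hunder, endSign_underEnd] at h2
        linarith
    have h3 : (D'.overInd d : ℚ) = D'.overInd c := by
      rw [overInd_eq hP, overInd_eq hP, h1, h2, hwq]
      ring
    exact_mod_cast h3
  rw [indexWrithe_eq_add_of_embedding f {c, d} (by simpa [not_or] using hrange) hdel.1
    (overInd_of_isPotential_comp hdel.1 hP hP'), sum_pair hcd, hind, hw]
  split_ifs <;> simp

/-- Alexander numberings after exchanging adjacent ends along an involution `σ`. -/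
lemma isPotential_of_exchange {e : Fin D.n ≃ Fin D'.n} {σ : Equiv.Perm D.End}
    (hnext : ∀ x : D.End,
      D'.next (e (σ x).1, (σ x).2) = (e (σ (D.next x)).1, (σ (D.next x)).2))
    (hinv : ∀ x, σ (σ x) = x)
    (hadj : ∀ x, σ x = x ∨ σ x = D.next x ∨ D.next (σ x) = x)
    (hnn : ∀ x, D.next (D.next x) ≠ x)
    {P : D.End → ℚ} (hP : D.IsPotential P) {R : D.End → ℚ}
    (hfirst : ∀ x, σ x = D.next x → R x = P x + endSign (σ x) - endSign x)
    (hrest : ∀ x, σ x ≠ D.next x → R x = P x) :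
    D'.IsPotential fun y => R (σ (e.symm y.1, y.2)) := by
  -- `R z` labels the edge after position `z`, which is occupied by `σ z` after the move. Only the
  -- edge between two exchanged ends gets a new label.
  have hR : ∀ z, R (D.next z) = R z + endSign (σ (D.next z)) := by
    intro z
    have hPz := hP z
    rcases hadj (D.next z) with h | h | h
    · have hz : σ z ≠ D.next z := by
        intro h1
        have h2 : D.next z = z := σ.injective (h.trans h1.symm)
        exact hnn z (by rw [h2, h2])
      have hz' : σ (D.next z) ≠ D.next (D.next z) := by
        intro h1
        have h2 : D.next z = z := D.next.injective (h1.symm.trans h)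
        exact hnn z (by rw [h2, h2])
      rw [hrest z hz, hrest _ hz', h, hPz]
    · have hz : σ z ≠ D.next z := by
        intro h1
        have h2 := hinv z
        rw [h1, h] at h2
        exact hnn z h2
      rw [hrest z hz, hfirst _ h, hPz]
      ring
    · have h1 : σ (D.next z) = z := D.next.injective h
      have h2 : σ z = D.next z := by rw [← hinv (D.next z), h1]
      have h3 : σ (D.next z) ≠ D.next (D.next z) := by
        rw [h1]
        exact (hnn z).symm
      rw [hrest _ h3, hfirst z h2, h1, h2, hPz]
      ring
  intro y
  obtain ⟨z, hz⟩ : ∃ z, σ z = (e.symm y.1, y.2) := σ.surjective _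
  have hy : y = (e (σ z).1, (σ z).2) := by rw [hz]; simp
  rw [hy, hnext]
  simp [hinv, hR, endSign]

/-- How an Alexander numbering changes at two neighbouring ends that are exchanged. -/
lemma exchange_of_neighbours {σ : Equiv.Perm D.End} {P R : D.End → ℚ} (hP : D.IsPotential P)
    (hnn : ∀ x, D.next (D.next x) ≠ x)
    (hfirst : ∀ x, σ x = D.next x → R x = P x + endSign (σ x) - endSign x)
    (hrest : ∀ x, σ x ≠ D.next x → R x = P x)
    {o : ℤˣ} {x y : D.End} (hxy : σ x = y) (hyx : σ y = x) (ho : D.Neighbours o x y) :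
    R (σ x) = P x + (o : ℤ) * endSign y ∧ R (σ y) = P y - (o : ℤ) * endSign x := by
  rcases ho with ⟨rfl, h⟩ | ⟨rfl, h⟩
  · have h1 := hfirst x (hxy.trans h.symm)
    have h2 := hrest y (by rw [hyx, ← h]; exact (hnn x).symm)
    have h3 := hP x
    rw [h] at h3
    rw [hxy] at h1
    rw [hxy, hyx, h1, h2, h3]
    constructor <;> push_cast <;> ring
  · have h1 := hfirst y (hyx.trans h.symm)
    have h2 := hrest x (by rw [hxy, ← h]; exact (hnn y).symm)
    have h3 := hP y
    rw [h] at h3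
    rw [hyx] at h1
    rw [hxy, hyx, h1, h2, h3]
    constructor <;> push_cast <;> ring

lemma Neighbours.next_eq {o : ℤˣ} {x y : D.End} (h : D.Neighbours o x y) :
    y = D.next x ∨ D.next y = x :=
  h.imp (fun h => h.2.symm) (fun h => h.2)

/-- At each of the three crossings the labels at the over- and under-end change by the same amount,
by one sign relation of the triangle per crossing. All other labels that enter an index are
unchanged. -/
lemma indexWrithe_eq_of_moveIII (h : MoveIII D D') (m : ℤ) :
    D.indexWrithe m = D'.indexWrithe m := by
  classical
  obtain ⟨e, a, b, c, t, μ, β, hab, hac, hbc, ht, hμ, hβ, hs₁, hs₂, hw, hnext⟩ := h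
  obtain ⟨P, hP⟩ := D.exists_isPotential
  set σ : Equiv.Perm D.End :=
        Equiv.swap (D.overEnd a) (D.overEnd b) * Equiv.swap (D.underEnd a) (D.overEnd c) *
          Equiv.swap (D.underEnd b) (D.underEnd c) with hσ
  have n1 := overEnd_injective.ne hab
  have n2 := overEnd_injective.ne hac
  have n3 := overEnd_injective.ne hbc
  obtain ⟨s1, s2, s3, s4, s5, s6⟩ : σ (D.overEnd a) = D.overEnd b ∧
      σ (D.overEnd b) = D.overEnd a ∧ σ (D.underEnd a) = D.overEnd c ∧
      σ (D.overEnd c) = D.underEnd a ∧ σ (D.underEnd b) = D.underEnd c ∧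
      σ (D.underEnd c) = D.underEnd b := by
    refine ⟨?_, ?_, ?_, ?_, ?_, ?_⟩ <;>
      simp [hσ, Equiv.swap_apply_def, overEnd_ne_underEnd, (overEnd_ne_underEnd _ _).symm,
        overEnd_injective.eq_iff, underEnd_injective.eq_iff, hab, hac, hbc,
        hab.symm, hac.symm, hbc.symm]
  have hcases : ∀ x : D.End, (x = D.overEnd a ∨ x = D.overEnd b ∨ x = D.underEnd a ∨
      x = D.overEnd c ∨ x = D.underEnd b ∨ x = D.underEnd c) ∨ σ x = x := by
    intro x
    by_cases h1 : x = D.overEnd a ∨ x = D.overEnd b ∨ x = D.underEnd a ∨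
      x = D.overEnd c ∨ x = D.underEnd b ∨ x = D.underEnd c
    · exact Or.inl h1
    · right
      simp only [not_or] at h1
      obtain ⟨h1, h2, h3, h4, h5, h6⟩ := h1
      rw [hσ, Equiv.Perm.mul_apply, Equiv.Perm.mul_apply, Equiv.swap_apply_of_ne_of_ne h5 h6,
        Equiv.swap_apply_of_ne_of_ne h3 h4, Equiv.swap_apply_of_ne_of_ne h1 h2]
  have hinv : ∀ x, σ (σ x) = x := by
    intro x
    rcases hcases x with (rfl | rfl | rfl | rfl | rfl | rfl) | h1
    · rw [s1, s2]
    · rw [s2, s1]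
    · rw [s3, s4]
    · rw [s4, s3]
    · rw [s5, s6]
    · rw [s6, s5]
    · rw [h1, h1]
  have hadj : ∀ x, σ x = x ∨ σ x = D.next x ∨ D.next (σ x) = x := by
    intro x
    rcases hcases x with (rfl | rfl | rfl | rfl | rfl | rfl) | h1
    · rw [s1]; exact Or.inr ht.next_eq
    · rw [s2]; exact Or.inr (ht.next_eq.symm.imp Eq.symm Eq.symm)
    · rw [s3]; exact Or.inr hμ.next_eq
    · rw [s4]; exact Or.inr (hμ.next_eq.symm.imp Eq.symm Eq.symm)
    · rw [s5]; exact Or.inr hβ.next_eq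
    · rw [s6]; exact Or.inr (hβ.next_eq.symm.imp Eq.symm Eq.symm)
    · exact Or.inl h1
  -- A circle with at most two ends cannot carry the three distinct over-ends of `a`, `b`, `c`.
  have hnn : ∀ x, D.next (D.next x) ≠ x := by
    intro x hx
    have h1 : ∀ y, y = x ∨ y = D.next x := by
      intro y
      have := eq_of_next_eq (S := D.toFlatDiagram) (G := fun y => y = x ∨ y = D.next x)
        (fun y => propext ⟨?_, ?_⟩) x y
      · exact this.mp (Or.inl rfl)
      · rintro (h2 | h2)
        · exact Or.inr (D.next.injective (h2.trans hx.symm))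
        · exact Or.inl (D.next.injective h2)
      · rintro (rfl | rfl)
        · exact Or.inr rfl
        · exact Or.inl hx
    rcases h1 (D.overEnd a) with h2 | h2 <;> rcases h1 (D.overEnd b) with h3 | h3 <;>
      rcases h1 (D.overEnd c) with h4 | h4
    all_goals first
      | exact n1 (h2.trans h3.symm)
      | exact n2 (h2.trans h4.symm)
      | exact n3 (h3.trans h4.symm)
  let R : D.End → ℚ := fun x =>
    if σ x = D.next x then P x + endSign (σ x) - endSign x else P x
  have hfirst : ∀ x, σ x = D.next x → R x = P x + endSign (σ x) - endSign x :=
    fun x hx => if_pos hx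
  have hrest : ∀ x, σ x ≠ D.next x → R x = P x := fun x hx => if_neg hx
  have hP' := isPotential_of_exchange hnext hinv hadj hnn hP hfirst hrest
  refine indexWrithe_eq_of_equiv e hw (fun d => ?_) m
  refine overInd_eq_overInd hP hP' (hw d) ?_
  rw [overEnd_of_writhe_eq (hw d), underEnd_of_writhe_eq (hw d)]
  simp only [Equiv.symm_apply_apply]
  change R (σ (D.underEnd d)) - R (σ (D.overEnd d)) = _
  obtain ⟨t1, t2⟩ := exchange_of_neighbours hP hnn hfirst hrest s1 s2 ht
  obtain ⟨m1, m2⟩ := exchange_of_neighbours hP hnn hfirst hrest s3 s4 hμ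
  obtain ⟨b1, b2⟩ := exchange_of_neighbours hP hnn hfirst hrest s5 s6 hβ
  rw [endSign_overEnd] at t1 t2 m1
  rw [endSign_underEnd] at m2 b1 b2
  have q₁ : ((t : ℤ) : ℚ) * (D.writhe a : ℤ) = (β : ℤ) * (D.writhe c : ℤ) := by
    exact_mod_cast congrArg (Units.val) hs₁
  have q₂ : ((β : ℤ) : ℚ) * (D.writhe b : ℤ) = (μ : ℤ) * (D.writhe a : ℤ) := by
    exact_mod_cast congrArg (Units.val) hs₂
  have q₃ : ((t : ℤ) : ℚ) * (D.writhe b : ℤ) = (μ : ℤ) * (D.writhe c : ℤ) := by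
    -- The third triangle relation is the product of the two given ones, with the unit `D.writhe a *
    -- β` cancelled.
    have hs₃ : t * D.writhe b = μ * D.writhe c := by
      apply mul_left_cancel (a := D.writhe a * β)
      calc D.writhe a * β * (t * D.writhe b)
          = (t * D.writhe a) * (β * D.writhe b) := by ac_rfl
        _ = (β * D.writhe c) * (μ * D.writhe a) := by rw [hs₁, hs₂]
        _ = D.writhe a * β * (μ * D.writhe c) := by ac_rfl
    exact_mod_cast congrArg (Units.val) hs₃
  by_cases hda : d = a
  · rw [hda, t1, m1]; linarith
  by_cases hdb : d = b
  · rw [hdb, t2, b1]; linarith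
  by_cases hdc : d = c
  · rw [hdc, m2, b2]; linarith
  have hfix : ∀ x : D.End, x.1 = d → R (σ x) = P x := by
    rintro x rfl
    have hx : σ x = x := by
      rcases hcases x with (rfl | rfl | rfl | rfl | rfl | rfl) | h1
      · exact absurd rfl hda
      · exact absurd rfl hdb
      · exact absurd rfl hda
      · exact absurd rfl hdc
      · exact absurd rfl hdb
      · exact absurd rfl hdc
      · exact h1
    rw [hx]
    refine hrest x fun h1 => hnn x ?_
    rw [← h1, hx, ← h1, hx]
  rw [hfix _ rfl, hfix _ rfl]

/-- The `m`-writhe is an invariant of virtual knots for `m ≠ 0`. -/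
theorem indexWrithe_eq_of_sameKnot (h : SameKnot D D') {m : ℤ} (hm : m ≠ 0) :
    D.indexWrithe m = D'.indexWrithe m := by
  induction h with
  | rel D D' h =>
    rcases h with h | h | h | h
    · exact indexWrithe_eq_of_isRenaming h m
    · exact indexWrithe_eq_of_moveI h hm
    · exact indexWrithe_eq_of_moveII h m
    · exact indexWrithe_eq_of_moveIII h m
  | refl => rfl
  | symm _ _ _ ih => exact ih.symm
  | trans _ _ _ _ _ ih₁ ih₂ => exact ih₁.trans ih₂

theorem IsClassical.indexWrithe_eq_zero (h : D.IsClassical) {m : ℤ} (hm : m ≠ 0) :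
    D.indexWrithe m = 0 := by
  obtain ⟨D', hD, hpl⟩ := h
  rw [indexWrithe_eq_of_sameKnot hD hm, indexWrithe]
  refine sum_eq_zero fun c _ => if_neg ?_
  rw [overInd, hpl.ind_eq_zero c, mul_zero]
  exact hm.symm

end VirtualDiagram

/-! ### Precrossings of nonzero index must be resolved. -/

namespace VirtualPseudodiagram

/-- In a necessarily classical pseudodiagram all precrossings have index `0`. -/
theorem NecessarilyClassical.ind_eq_zero {V : VirtualPseudodiagram} (hV : V.NecessarilyClassical)
    {c : Fin V.n} (hc : V.writhe c = none) : V.ind c = 0 := by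
  by_contra hm
  let D : ℤˣ → VirtualDiagram := fun ε => V.complete fun d => if d = c then ε else 1
  have hzero : ∀ ε, (D ε).indexWrithe (V.ind c) = 0 := fun ε => (hV _).indexWrithe_eq_zero hm
  have hval : ∀ ε : ℤˣ, (D ε).indexWrithe (V.ind c) =
      (if (ε : ℤ) * V.ind c = V.ind c then (ε : ℤ) else 0) +
      ∑ d ∈ univ.erase c, if ((V.writhe d).getD 1 : ℤ) * V.ind d = V.ind c
        then ((V.writhe d).getD 1 : ℤ) else 0 := by
    intro ε
    change ∑ d : Fin V.n, (if (((V.writhe d).getD (if d = c then ε else 1) : ℤˣ) : ℤ) * V.ind d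
      = V.ind c then (((V.writhe d).getD (if d = c then ε else 1) : ℤˣ) : ℤ) else 0) = _
    rw [← add_sum_erase univ _ (mem_univ c)]
    congr 1
    · simp [hc]
    · refine sum_congr rfl fun d hd => ?_
      rw [if_neg (ne_of_mem_erase hd)]
  have h1 := (hval 1).symm.trans (hzero 1)
  have h2 := (hval (-1)).symm.trans (hzero (-1))
  -- With `ε = 1` the crossing `c` counts towards its own index; with `ε = -1` its signed index is
  -- the negative and it drops out. The remaining sum is the same in both cases and would have to be
  -- both `-1` and `0`.
  rw [if_pos (by simp)] at h1
  rw [if_neg (by push_cast; omega)] at h2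
  push_cast at h1
  omega

/-- The crossings of nonzero index, counted according to their indices. -/
lemma finsum_ncard_C (S : FlatDiagram) :
    ∑ᶠ (m : ℤ) (_ : m ≠ 0), (S.C m).ncard = #{c | S.ind c ≠ 0} := by
  classical
  rw [card_eq_sum_card_image S.ind]
  have hC : ∀ m, m ≠ 0 → (S.C m).ncard = #{c ∈ ({c | S.ind c ≠ 0} : Finset _) | S.ind c = m} := by
    intro m hm
    rw [← Set.ncard_coe_finset]
    congr 1
    ext c
    simp only [FlatDiagram.C, Set.mem_ofPred_eq, coe_filter, mem_filter, mem_univ, true_and]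
    exact ⟨fun h => ⟨h ▸ hm, h⟩, fun h => h.2⟩
  rw [finsum_congr fun m => finsum_congr (hC m)]
  refine finsum_cond_eq_sum_of_cond_iff _ fun {m} hm => ?_
  obtain ⟨c, hc⟩ := card_ne_zero.1 hm
  rw [mem_filter] at hc
  refine ⟨fun _ => mem_image.2 ⟨c, hc⟩, fun h => ?_⟩
  obtain ⟨d, hd, rfl⟩ := mem_image.1 h
  exact (mem_filter.1 hd).2

end VirtualPseudodiagram

end VirtualKnot

theorem mainTheorem9 (S : VirtualKnot.VirtualPseudodiagram) (hS : S.IsShadow) :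
    ((∑ᶠ (m : ℤ) (_ : m ≠ 0), (S.C m).ncard : ℕ) : ℕ∞) ≤ S.cl := by
  refine le_sInf ?_
  rintro k ⟨T, w, -, hV, rfl⟩
  rw [VirtualKnot.VirtualPseudodiagram.finsum_ncard_C S.toFlatDiagram, Nat.cast_le]
  refine Finset.card_le_card fun c hc => ?_
  -- Resolving crossings does not alter the flat diagram, so `c` keeps its index and is still a
  -- precrossing of a necessarily classical diagram.
  by_contra hcT
  refine (Finset.mem_filter.1 hc).2 (hV.ind_eq_zero (c := c) ?_)
  simp [VirtualKnot.VirtualPseudodiagram.resolve, hcT, hS c]
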